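/- Let $\mathcal{N}$ be a directed acyclic network: a finite directed acyclic multigraph with vertex set $\mathcal{V}$ and edge set $\mathcal{E}$, a nonempty set $S=\{\sigma_1,\dots,\sigma_s\}$ of source nodes without incoming edges, and a sink node $\gamma\notin S$, such that every node other than $\gamma$ has a directed path to $\gamma$. A cut is a set $C\subseteq\mathcal{E}$ such that, for some source $\sigma_i$, every directed path from $\sigma_i$ to $\gamma$ contains an edge of $C$; let $h$ be the minimum of $|C|$ over all cuts $C$. A scalar linear network code $\mathcal{C}$ of rate $k$ over $\mathbb{F}_q$ consists of coefficients $k_{(i,j),e}$ and $k_{d,e}$ in $\mathbb{F}_q$ ($1\le i\le s$, $1\le j\le k$, $d,e\in\mathcal{E}$), where $k_{(i,j),e}=0$ unless $e$ leaves $\sigma_i$, and $k_{d,e}=0$ unless $e$ leaves the head of $d$. If the sources hold $\mathbf{x}=(x_{ij})\in\mathbb{F}_q^{sk}$ and an error $z_e\in\mathbb{F}_q$ is added on each edge $e$, then the edges carry the symbols $$u_e=\sum_{i,j}x_{ij}k_{(i,j),e}+\sum_{d\in\mathcal{E}}u_d\,k_{d,e}+z_e ,$$ and the sink receives $(u_e)_e$,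 $e$ ranging over the incoming edges of $\gamma$; this vector is $\mathbf{x}F+\mathbf{z}G$ for matrices $F,G$ determined by the code. The code computes the sum of the source messages $k$ times if $\mathbf{x}F$ determines $\sum_{i=1}^s\mathbf{x}_i\in\mathbb{F}_q^k$, where $\mathbf{x}_i=(x_{i1},\dots,x_{ik})$. Its minimum distance $d_{\min}(\mathcal{C},\mathbf{1},k)$ is the least size $|\rho|$ of a set $\rho\subseteq\mathcal{E}$ for which there are $\mathbf{x}$ with $\sum_i\mathbf{x}_i\neq\mathbf{0}$ and $\mathbf{z}\in\mathbb{F}_q^{\mathcal{E}}$, vanishing outside $\rho$, with $\mathbf{x}F=\mathbf{z}G$. Theorem. Let $k$ be a positive integer with $k\le h$. Then there is $q_0$, depending only on $\mathcal{N}$ and $k$, such that for every prime power $q\ge q_0$ there is a scalar linear network code $\mathcal{C}$ over $\mathbb{F}_q$ that computes the sum of the source messages $k$ times and satisfies $$d_{\min}(\mathcal{C},\mathbf{1},k)=h-k+1=\min_{C}\,(|C|-k+1),$$ the last minimum being over all cuts $C$ of $\mathcal{N}$. -/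

import Mathlib

open scoped Matrix Kronecker

/-- The edge sequence `l` is a directed path from `u` to `v` in the multigraph with edge set `E`
and endpoint maps `tail`, `head` (the empty sequence is a path from every vertex to itself). -/
def IsDiPath {V E : Type*} (tail head : E → V) : V → List E → V → Prop
  | u, [], v => u = v
  | u, e :: l, v => tail e = u ∧ IsDiPath tail head (head e) l v

/-- A directed acyclic network: a directed acyclic multigraph with vertex set `V` and edge set `E`,
a nonempty finite set of source nodes and a sink node which is not a source, such that sources
have no incoming edges and every node other than the sink has a directed path to the sink. -/
structure Network (V E : Type*) where
  tail : E → V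
  head : E → V
  acyclic : ∀ (v : V) (l : List E), IsDiPath tail head v l v → l = []
  sources : Finset V
  sources_nonempty : sources.Nonempty
  sink : V
  sink_notMem : sink ∉ sources
  no_in_source : ∀ e, head e ∉ sources
  path_to_sink : ∀ u, u ≠ sink → ∃ l : List E, IsDiPath tail head u l sink

namespace Network

variable {V E : Type*}

/-- The incoming edges of the sink. -/
abbrev InSink (N : Network V E) : Type _ := {e : E // N.head e = N.sink}

/-- `C` is a cut of the network: for some source, every directed path from that source to the sink
contains an edge of `C`. -/
def IsCut (N : Network V E) (C : Finset E) : Prop :=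
  ∃ σ ∈ N.sources, ∀ l : List E, IsDiPath N.tail N.head σ l N.sink → ∃ e ∈ l, e ∈ C

/-- The minimum size of a cut of the network. -/
noncomputable def minCut (N : Network V E) : ℕ :=
  sInf {n | ∃ C : Finset E, N.IsCut C ∧ C.card = n}

/-- A network with finitely many edges has a cut, so the minimum above is a genuine one. -/
theorem exists_isCut_card_eq_minCut [Fintype E] (N : Network V E) :
    ∃ C : Finset E, N.IsCut C ∧ C.card = N.minCut := by
  have h : {n | ∃ C : Finset E, N.IsCut C ∧ C.card = n}.Nonempty := by
    obtain ⟨σ, hσ⟩ := N.sources_nonempty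
    refine ⟨_, Finset.univ, ⟨σ, hσ, ?_⟩, rfl⟩
    intro l hl
    cases l with
    | nil =>
      have h1 : σ = N.sink := hl
      exact absurd (h1 ▸ hσ) N.sink_notMem
    | cons e l => exact ⟨e, by simp, by simp⟩
  exact Nat.sInf_mem h

end Network

/-- A scalar linear network code, i.e. a `(k, 1)` linear network code, over `F` for the network `N`.
Each source `σ` generates `k` symbols of `F`, and each edge carries one symbol of `F`.
`src (σ, j) e` is the coefficient at the edge `e` of the `j`-th message symbol of the source `σ`;
`transfer d e` is the coefficient at the edge `e` of the symbol carried by the edge `d`. -/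
structure LinearCode {V E : Type*} (N : Network V E) (k : ℕ) (F : Type*) [Field F] where
  src : Matrix (N.sources × Fin k) E F
  transfer : Matrix E E F
  src_eq_zero : ∀ (σ : N.sources) (j : Fin k) (e : E), N.tail e ≠ σ → src (σ, j) e = 0
  transfer_eq_zero : ∀ d e : E, N.tail e ≠ N.head d → transfer d e = 0

namespace LinearCode

variable {V E : Type*} {N : Network V E} {k : ℕ} {F : Type*} [Field F]
  [Fintype E] [DecidableEq E]

/-- The symbols `u e` are the ones carried by the edges when the sources send `x` and the error
`z e` is added on each edge `e`: every edge carries the prescribed linear combination of the symbols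
available at its tail, plus its error. -/
def IsTransmission (C : LinearCode N k F) (x : N.sources × Fin k → F) (z u : E → F) : Prop :=
  ∀ e, u e = ∑ i, x i * C.src i e + ∑ d, u d * C.transfer d e + z e

/-- The lower block of the extended global encoding matrix: its row `e` is the
contribution to the received vector of a unit error on the edge `e`. -/
noncomputable def errMatrix (C : LinearCode N k F) : Matrix E N.InSink F :=
  ((1 - C.transfer)⁻¹).submatrix id Subtype.val

/-- The global encoding matrix. -/
noncomputable def encMatrix (C : LinearCode N k F) : Matrix (N.sources × Fin k) N.InSink F :=
  C.src * C.errMatrix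

/-- `I - K` is invertible because the network is acyclic. -/
theorem isUnit_one_sub_transfer (C : LinearCode N k F) : IsUnit (1 - C.transfer) := by
  let r : E → E → Prop := fun d e => N.head d = N.tail e
  have key : ∀ d e, Relation.TransGen r d e →
      ∃ l : List E, l ≠ [] ∧ IsDiPath N.tail N.head (N.tail d) l (N.tail e) := by
    intro d e h
    induction h using Relation.TransGen.head_induction_on with
    | single h => exact ⟨[_], by simp, rfl, h⟩
    | head h _ ih =>
      obtain ⟨l, _, hl⟩ := ih
      refine ⟨_ :: l, by simp, rfl, ?_⟩
      have h1 : N.head _ = N.tail _ := h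
      rw [h1]
      exact hl
  have irr : ∀ e, ¬ Relation.TransGen r e e := by
    intro e h
    obtain ⟨l, hne, hl⟩ := key e e h
    exact hne (N.acyclic _ l hl)
  have : Std.Irrefl (Relation.TransGen r) := ⟨irr⟩
  have wf : WellFounded (Relation.TransGen r) := Finite.wellFounded_of_trans_of_irrefl _
  rw [← Matrix.vecMul_injective_iff_isUnit]
  have hz : ∀ v : E → F, v ᵥ* (1 - C.transfer) = 0 → v = 0 := by
    intro v hv
    rw [Matrix.vecMul_sub, Matrix.vecMul_one, sub_eq_zero] at hv
    funext e
    induction e using wf.induction with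
    | _ e ih =>
      rw [hv]
      refine Finset.sum_eq_zero fun d _ => ?_
      by_cases hd : N.tail e = N.head d
      · have h0 : v d = 0 := ih d (Relation.TransGen.single hd.symm)
        simp [h0]
      · simp [C.transfer_eq_zero d e hd]
  intro v w hvw
  have h2 : (v - w) ᵥ* (1 - C.transfer) = 0 := by
    rw [Matrix.sub_vecMul]
    exact sub_eq_zero.2 hvw
  exact sub_eq_zero.1 (hz _ h2)

/-- For every message `x` and every error vector `z` there is exactly one transmission, and the
vector which the sink then receives is `x F + z G`. -/
theorem existsUnique_isTransmission (C : LinearCode N k F) (x : N.sources × Fin k → F)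
    (z : E → F) : ∃ u, C.IsTransmission x z u ∧ (∀ u', C.IsTransmission x z u' → u' = u) ∧
      (fun e : N.InSink => u e) = x ᵥ* C.encMatrix + z ᵥ* C.errMatrix := by
  have hu := C.isUnit_one_sub_transfer
  have hd := (Matrix.isUnit_iff_isUnit_det _).1 hu
  have hiff : ∀ u, C.IsTransmission x z u ↔ u ᵥ* (1 - C.transfer) = x ᵥ* C.src + z := by
    intro u
    rw [Matrix.vecMul_sub, Matrix.vecMul_one, sub_eq_iff_eq_add, funext_iff]
    refine forall_congr' fun e => ?_
    simp only [Pi.add_apply, Matrix.vecMul, dotProduct]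
    rw [add_right_comm]
  refine ⟨(x ᵥ* C.src + z) ᵥ* (1 - C.transfer)⁻¹, ?_, ?_, ?_⟩
  · rw [hiff, Matrix.vecMul_vecMul, Matrix.nonsing_inv_mul _ hd, Matrix.vecMul_one]
  · intro u' h
    rw [hiff] at h
    rw [← h, Matrix.vecMul_vecMul, Matrix.mul_nonsing_inv _ hd, Matrix.vecMul_one]
  · rw [encMatrix, ← Matrix.vecMul_vecMul, ← Matrix.add_vecMul]
    rfl

/-- The target `x (T ⊗ I)`, that is, `k` evaluations of the linear function `x T`. -/
def target {L : Type*} (k : ℕ) (T : Matrix N.sources L F) (x : N.sources × Fin k → F) :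
    L × Fin k → F :=
  x ᵥ* (T ⊗ₖ (1 : Matrix (Fin k) (Fin k) F))

/-- The sink can compute the target function `x T` with rate `k` from the vector it receives
in the absence of errors. -/
def Computes {L : Type*} (C : LinearCode N k F) (T : Matrix N.sources L F) : Prop :=
  ∃ φ : (N.InSink → F) → (L × Fin k → F), ∀ x, φ (x ᵥ* C.encMatrix) = target k T x

/-- The error-free received vectors of the messages with nonzero target value. -/
def Phi {L : Type*} (C : LinearCode N k F) (T : Matrix N.sources L F) : Set (N.InSink → F) :=
  {y | ∃ x, target k T x ≠ 0 ∧ y = x ᵥ* C.encMatrix}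

/-- The vectors produced at the sink by the error vectors supported in the error pattern `ρ`. -/
def Delta (C : LinearCode N k F) (ρ : Finset E) : Set (N.InSink → F) :=
  {y | ∃ z : E → F, (∀ e, e ∉ ρ → z e = 0) ∧ y = z ᵥ* C.errMatrix}

/-- The minimum distance of the code with respect to the target function `x T`. -/
noncomputable def minDist {L : Type*} (C : LinearCode N k F) (T : Matrix N.sources L F) : ℕ :=
  sInf {n | ∃ ρ : Finset E, (C.Phi T ∩ C.Delta ρ).Nonempty ∧ ρ.card = n}

end LinearCode

/-- The all-ones column, whose target function is the sum of the source messages. -/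
def sumTarget {V E : Type*} (N : Network V E) (F : Type*) [Field F] :
    Matrix N.sources Unit F :=
  fun _ _ => 1

theorem target_sumTarget {V E : Type*} (N : Network V E) (F : Type*) [Field F] (k : ℕ)
    (x : N.sources × Fin k → F) (j : Fin k) :
    LinearCode.target k (sumTarget N F) x ((), j) = ∑ σ : N.sources, x (σ, j) := by
  simp [LinearCode.target, sumTarget, Matrix.vecMul, dotProduct, Fintype.sum_prod_type,
    Matrix.one_apply]

/-! Upper bound: in a minimum cut for a source `σ`, all that `σ` contributes to the sink passes
through the `h` cut edges. Linear algebra gives a nonzero message of `σ` whose effect vanishes on `k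
- 1` of them, so errors on the other `h - k + 1` imitate it (`exists_card_eq_of_computes`).

Construction: work backwards from the sink. Give each edge `e` a vector `g e` in `W = F^h`, free if
`e` enters the sink and otherwise a combination of the vectors of the edges that follow `e`. A
generic choice makes the edges leaving each source span `W` (`exists_edgeVectors`). Pick `w_1, …,
w_k` whose nontrivial combinations avoid the span of any `h - k` edge vectors
(`exists_vectors_sum_smul_notMem`), and let every source inject its `j`-th symbol so that it
represents the same `w_j`. A linear map `D` at the sink then sends `x F` to the combination of the
`w_j` with coefficients the message sums, and `z G` to `∑ z_e g_e`. These differ when the sum is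
nonzero and at most `h - k` edges err. -/

/-! ### Avoiding finitely many subspaces over a large field. -/

theorem Submodule.exists_mem_forall_notMem {F W ι : Type*} [Field F] [AddCommGroup W] [Module F W]
    [Fintype ι] (hF : (Fintype.card ι : ℕ∞) < ENat.card F) (p : Submodule F W)
    (U : ι → Submodule F W) (hU : ∀ i, ¬ p ≤ U i) : ∃ v ∈ p, ∀ i, v ∉ U i := by
  have h := Submodule.iUnion_ssubset_of_forall_ne_top_of_card_lt Finset.univ
    (fun i => (U i).comap p.subtype) (fun i hi => hU i (Submodule.comap_subtype_eq_top.1 hi)) hF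
  obtain ⟨v, -, hv⟩ := Set.exists_of_ssubset h
  simp only [Finset.mem_univ, Set.iUnion_true, Set.mem_iUnion, not_exists] at hv
  exact ⟨v, v.2, hv⟩

/-- Over a large field there are `k` vectors whose nontrivial linear combinations avoid finitely
many given subspaces of codimension at least `k`. -/
theorem exists_vectors_sum_smul_notMem {F W ι : Type*} [Field F] [AddCommGroup W] [Module F W]
    [FiniteDimensional F W] [Fintype ι] (hF : (Fintype.card ι : ℕ∞) < ENat.card F)
    (U : ι → Submodule F W) {r : ℕ} (hU : ∀ i, Module.finrank F (U i) ≤ r) (k : ℕ)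
    (hk : k + r ≤ Module.finrank F W) :
    ∃ w : Fin k → W, ∀ m : Fin k → F, m ≠ 0 → ∀ i, ∑ j, m j • w j ∉ U i := by
  induction k with
  | zero => exact ⟨0, fun m hm => absurd (Subsingleton.elim m 0) hm⟩
  | succ k ih =>
    obtain ⟨w, hw⟩ := ih (by omega)
    -- The sums with the span of the earlier vectors have dimension at most `r + k`, below `dim W`,
    -- so they are proper.
    obtain ⟨v, -, hv⟩ := Submodule.exists_mem_forall_notMem hF ⊤
      (fun i => U i ⊔ Submodule.span F (Set.range w)) (by
        intro i hi
        have h1 := Submodule.finrank_add_le_finrank_add_finrank (U i)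
          (Submodule.span F (Set.range w))
        have h2 := finrank_range_le_card (R := F) w
        rw [top_le_iff.1 hi, finrank_top] at h1
        have h3 := hU i
        rw [Set.finrank, Fintype.card_fin] at h2
        omega)
    refine ⟨Fin.cons v w, fun m hm i hi => ?_⟩
    rw [Fin.sum_univ_succ] at hi
    simp only [Fin.cons_zero, Fin.cons_succ] at hi
    by_cases h0 : m 0 = 0
    · rw [h0, zero_smul, zero_add] at hi
      refine hw (fun j => m j.succ) (fun h => hm ?_) i hi
      funext j
      refine Fin.cases h0 (fun j => congrFun h j) j
    · refine hv i ?_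
      have hs : ∑ j : Fin k, m j.succ • w j ∈ Submodule.span F (Set.range w) :=
        Submodule.sum_mem _ fun j _ => Submodule.smul_mem _ _ (Submodule.subset_span ⟨j, rfl⟩)
      rw [← Submodule.smul_mem_iff _ h0]
      have := Submodule.sub_mem _ (Submodule.mem_sup_left (T := Submodule.span F (Set.range w)) hi)
        (Submodule.mem_sup_right (S := U i) hs)
      simpa using this

/-! ### Separators and generic vectors on the edges. -/

namespace Network

variable {V E : Type*}

/-- The relation "`d` can directly follow `e` on a path" is well-founded. -/
theorem wellFounded_follows [Finite E] (N : Network V E) :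
    WellFounded fun d e => N.head e = N.tail d := by
  have key : ∀ d e, Relation.TransGen (fun d e => N.head e = N.tail d) d e →
      ∃ l : List E, l ≠ [] ∧ IsDiPath N.tail N.head (N.tail e) l (N.tail d) := by
    intro d e h
    induction h with
    | single h => exact ⟨[_], by simp, rfl, h⟩
    | @tail b c _ h ih =>
      obtain ⟨l, -, hl⟩ := ih
      exact ⟨c :: l, by simp, rfl, h ▸ hl⟩
  have : Std.Irrefl (Relation.TransGen fun d e => N.head e = N.tail d) := by
    refine ⟨fun e h => ?_⟩
    obtain ⟨l, hne, hl⟩ := key e e h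
    exact hne (N.acyclic _ l hl)
  refine Subrelation.wf (r := Relation.TransGen fun d e => N.head e = N.tail d) ?_
    (Finite.wellFounded_of_trans_of_irrefl _)
  intro d e h
  exact Relation.TransGen.single h

/-- Every path to the sink that starts with an edge of `T` contains an edge of `C`. -/
def Separates (N : Network V E) (C T : Finset E) : Prop :=
  ∀ e ∈ T, ∀ l, IsDiPath N.tail N.head (N.head e) l N.sink → ∃ c ∈ e :: l, c ∈ C

theorem minCut_le_card_of_separates [Fintype E] [DecidableEq V] (N : Network V E) {σ : V}
    (hσ : σ ∈ N.sources) {C : Finset E} (hC : N.Separates C ({e | N.tail e = σ} : Finset E)) :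
    N.minCut ≤ C.card := by
  refine Nat.sInf_le ⟨C, ⟨σ, hσ, fun l hl => ?_⟩, rfl⟩
  cases l with
  | nil =>
    have h1 : σ = N.sink := hl
    exact absurd (h1 ▸ hσ) N.sink_notMem
  | cons e l => exact hC e (by simpa using hl.1) l hl.2

/-- Since `e` does not enter the sink, a path starting with `e` has a second edge, which lies in the
enlarged set. -/
theorem Separates.of_follows [Fintype E] [DecidableEq V] [DecidableEq E] {N : Network V E}
    {C T : Finset E} {e : E} (he : N.head e ≠ N.sink)
    (h : N.Separates C (T ∪ ({d | N.tail d = N.head e} : Finset E))) :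
    N.Separates C (insert e T) := by
  intro d hd l hl
  rcases Finset.mem_insert.1 hd with rfl | hd
  · cases l with
    | nil => exact absurd hl he
    | cons d' l =>
      obtain ⟨c, hc, hcC⟩ := h d' (by simp [hl.1]) l hl.2
      exact ⟨c, List.mem_cons_of_mem _ hc, hcC⟩
  · exact h d (by simp [hd]) l hl

theorem Separates.insert [DecidableEq E] {N : Network V E} {C T : Finset E} (e : E)
    (h : N.Separates C T) : N.Separates (insert e C) (insert e T) := by
  intro d hd l hl
  rcases Finset.mem_insert.1 hd with rfl | hd
  · exact ⟨d, by simp, by simp⟩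
  · obtain ⟨c, hc, hcC⟩ := h d hd l hl
    exact ⟨c, hc, Finset.mem_insert_of_mem hcC⟩

variable {F W : Type*} [Field F] [AddCommGroup W] [Module F W]

/-- The space in which the vector of the edge `e` may be chosen, given those of the edges leaving
the head of `e`. -/
def choiceSpace (N : Network V E) (F : Type*) [Field F] [Module F W] (g : E → W) (e : E) :
    Submodule F W :=
  -- For an edge into the sink the condition is vacuous and the span is all of `W`.
  Submodule.span F {v | N.head e ≠ N.sink → ∃ d, N.tail d = N.head e ∧ g d = v}

theorem choiceSpace_of_eq (N : Network V E) (g : E → W) {e : E} (he : N.head e = N.sink) :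
    N.choiceSpace F g e = ⊤ := by
  simp [choiceSpace, he]

theorem choiceSpace_of_ne (N : Network V E) (g : E → W) {e : E} (he : N.head e ≠ N.sink) :
    N.choiceSpace F g e = Submodule.span F (g '' {d | N.tail d = N.head e}) := by
  simp only [choiceSpace, he, ne_eq, not_false_eq_true, forall_const]
  rfl

theorem choiceSpace_congr (N : Network V E) {g g' : E → W} {e : E}
    (h : ∀ d, N.tail d = N.head e → g d = g' d) :
    N.choiceSpace F g e = N.choiceSpace F g' e := by
  by_cases he : N.head e = N.sink
  · rw [choiceSpace_of_eq N g he, choiceSpace_of_eq N g' he]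
  · rw [choiceSpace_of_ne N g he, choiceSpace_of_ne N g' he]
    exact congrArg _ (Set.image_congr h)

/-- The set `T` of edges has vectors of as high a rank as its separators from the sink permit. -/
def IsGenericOn (N : Network V E) (F : Type*) [Field F] [Module F W] (g : E → W) (T : Finset E) :
    Prop :=
  Submodule.span F (g '' T) = ⊤ ∨
    ∃ C, N.Separates C T ∧ C.card ≤ Module.finrank F (Submodule.span F (g '' T))

/-- If `g e` leaves the span of `T`, the rank grows by one, which pays for adding `e` to a separator
of `T`. Otherwise the span of `T` is already `⊤` or contains the vectors of all followers of `e`;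
adjoining these followers leaves the rank unchanged, and a separator of the larger set also serves
`insert e T`. -/
theorem isGenericOn_insert [Fintype E] [DecidableEq V] [DecidableEq E] [FiniteDimensional F W]
    (N : Network V E) {g : E → W} {T : Finset E} {e : E}
    (hg : ¬ N.choiceSpace F g e ≤ Submodule.span F (g '' T) → g e ∉ Submodule.span F (g '' T))
    (hT : N.IsGenericOn F g T)
    (hT' : N.IsGenericOn F g (T ∪ ({d | N.tail d = N.head e} : Finset E))) :
    N.IsGenericOn F g (insert e T) := by
  have hmono : Submodule.span F (g '' T) ≤ Submodule.span F (g '' (insert e T : Finset E)) :=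
    Submodule.span_mono (Set.image_mono (by simp))
  by_cases hle : N.choiceSpace F g e ≤ Submodule.span F (g '' T)
  · by_cases he : N.head e = N.sink
    · rw [choiceSpace_of_eq N g he, top_le_iff] at hle
      exact Or.inl (top_le_iff.1 (hle ▸ hmono))
    · rw [choiceSpace_of_ne N g he] at hle
      have hspan : Submodule.span F
          (g '' (T ∪ ({d | N.tail d = N.head e} : Finset E) : Finset E)) =
          Submodule.span F (g '' T) := by
        rw [Finset.coe_union, Set.image_union, Submodule.span_union, sup_eq_left]
        simpa using hle
      rw [IsGenericOn, hspan] at hT'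
      rcases hT' with h | ⟨C, hC, hcard⟩
      · exact Or.inl (top_le_iff.1 (h ▸ hmono))
      · exact Or.inr ⟨C, hC.of_follows he, hcard.trans (Submodule.finrank_mono hmono)⟩
  · rcases hT with h | ⟨C, hC, hcard⟩
    · exact Or.inl (top_le_iff.1 (h ▸ hmono))
    · refine Or.inr ⟨insert e C, hC.insert e, (Finset.card_insert_le _ _).trans ?_⟩
      refine (Nat.succ_le_succ hcard).trans (Submodule.finrank_lt_finrank_of_lt ?_)
      refine lt_of_le_of_ne hmono fun h => hg hle ?_
      rw [h]
      exact Submodule.subset_span ⟨e, by simp, rfl⟩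

/-- Edges are processed from the sink backwards, `P` being those done. Genericity is carried for all
subsets of `P` at once, because the insertion step compares `T` with `T` enlarged by the followers
of `e`. -/
theorem exists_generic_edgeVectors_on [Fintype E] [DecidableEq V] [DecidableEq E]
    [FiniteDimensional F W] (N : Network V E)
    (hF : ((2 ^ Fintype.card E : ℕ) : ℕ∞) < ENat.card F) (n : ℕ) (hn : n ≤ Fintype.card E) :
    ∃ P : Finset E, P.card = n ∧ (∀ e ∈ P, ∀ d, N.tail d = N.head e → d ∈ P) ∧
      ∃ g : E → W, (∀ e ∈ P, g e ∈ N.choiceSpace F g e) ∧ ∀ T ⊆ P, N.IsGenericOn F g T := by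
  classical
  induction n with
  | zero =>
    refine ⟨∅, rfl, by simp, 0, by simp, fun T hT => Or.inr ⟨∅, ?_, by simp⟩⟩
    rw [Finset.subset_empty.1 hT]
    intro e he
    simp at he
  | succ n ih =>
    obtain ⟨P, hPn, hP, g, hg, hgen⟩ := ih (by omega)
    obtain ⟨a, ha⟩ : ∃ a, a ∉ P := by
      by_contra! h
      rw [Finset.eq_univ_iff_forall.2 h, Finset.card_univ] at hPn
      omega
    obtain ⟨e, he, hmin⟩ := N.wellFounded_follows.has_min {e | e ∉ P} ⟨a, ha⟩
    have hfol : ∀ d, N.tail d = N.head e → d ∈ P := fun d hd => by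
      by_contra h
      exact hmin d h hd.symm
    have hne : ∀ d ∈ P, d ≠ e := fun d hd h => he (h ▸ hd)
    -- One vector must serve every `T`; there are at most `2 ^ |E|` spans to avoid, whence the bound
    -- on the field.
    obtain ⟨v, hv, hvU⟩ := Submodule.exists_mem_forall_notMem
      (ι := {T : Finset E // ¬ N.choiceSpace F g e ≤ Submodule.span F (g '' T)})
      (lt_of_le_of_lt (by
        rw [Nat.cast_le, ← Fintype.card_finset]
        exact Fintype.card_subtype_le _) hF)
      (N.choiceSpace F g e) (fun T => Submodule.span F (g '' T.1)) (fun T => T.2)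
    have hup : ∀ d ∈ P, Function.update g e v d = g d := fun d hd =>
      Function.update_of_ne (hne d hd) _ _
    -- The followers of these edges all lie in `P`, so the update at `e` does not affect their
    -- vectors.
    have hspace : ∀ d ∈ insert e P,
        N.choiceSpace F (Function.update g e v) d = N.choiceSpace F g d := by
      intro d hd
      refine N.choiceSpace_congr fun d' hd' => hup d' ?_
      rcases Finset.mem_insert.1 hd with rfl | hd
      · exact hfol d' hd'
      · exact hP d hd d' hd'
    have himage : ∀ T ⊆ P, Function.update g e v '' T = g '' T := fun T hT =>
      Set.image_congr fun d hd => hup d (hT hd)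
    have hgen' : ∀ T ⊆ P, N.IsGenericOn F (Function.update g e v) T := by
      intro T hT
      rw [IsGenericOn, himage T hT]
      exact hgen T hT
    refine ⟨insert e P, by rw [Finset.card_insert_of_notMem he, hPn], ?_,
      Function.update g e v, ?_, ?_⟩
    · intro d hd d' hd'
      rcases Finset.mem_insert.1 hd with rfl | hd
      · exact Finset.mem_insert_of_mem (hfol d' hd')
      · exact Finset.mem_insert_of_mem (hP d hd d' hd')
    · intro d hd
      rw [hspace d hd]
      rcases Finset.mem_insert.1 hd with rfl | hd
      · simpa using hv
      · rw [hup d hd]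
        exact hg d hd
    · intro T hT
      by_cases heT : e ∈ T
      · have hT0 : T.erase e ⊆ P := Finset.subset_insert_iff.1 hT
        rw [← Finset.insert_erase heT]
        refine N.isGenericOn_insert ?_ (hgen' _ hT0) (hgen' _ (Finset.union_subset hT0 ?_))
        · rw [himage _ hT0, hspace e (by simp), Function.update_self]
          exact fun h => hvU ⟨_, h⟩
        · intro d hd
          exact hfol d (by simpa using hd)
      · refine hgen' T fun d hd => ?_
        exact Finset.mem_of_mem_insert_of_ne (hT hd) fun h => heT (h ▸ hd)

/-- Over a large field the edges can be given vectors of a space whose dimension is the minimum cut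
such that every edge not entering the sink has a linear combination of the vectors of its
successors, and the edges leaving any source have a spanning set of vectors. -/
theorem exists_edgeVectors [Fintype E] [DecidableEq E] [FiniteDimensional F W] (N : Network V E)
    (hF : ((2 ^ Fintype.card E : ℕ) : ℕ∞) < ENat.card F) (hW : Module.finrank F W = N.minCut) :
    ∃ g : E → W,
      (∀ e, N.head e ≠ N.sink → g e ∈ Submodule.span F (g '' {d | N.tail d = N.head e})) ∧
      ∀ σ ∈ N.sources, Submodule.span F (g '' {e | N.tail e = σ}) = ⊤ := by
  classical
  obtain ⟨P, hPn, -, g, hg, hgen⟩ :=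
    N.exists_generic_edgeVectors_on (F := F) (W := W) hF (Fintype.card E) le_rfl
  obtain rfl := (Finset.card_eq_iff_eq_univ P).1 hPn
  refine ⟨g, fun e he => N.choiceSpace_of_ne (F := F) g he ▸ hg e (by simp), fun σ hσ => ?_⟩
  have h := hgen ({e | N.tail e = σ} : Finset E) (by simp)
  rw [IsGenericOn, Finset.coe_filter_univ] at h
  rcases h with h | ⟨C, hC, hcard⟩
  · exact h
  · refine Submodule.eq_top_of_finrank_eq (le_antisymm (Submodule.finrank_le _) ?_)
    rw [hW]
    exact (N.minCut_le_card_of_separates hσ hC).trans hcard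

end Network

namespace LinearCode

variable {V E : Type*} {N : Network V E} {k : ℕ} {F : Type*} [Field F]
  [Fintype E] [DecidableEq E]

/-! ### The Singleton-type upper bound. -/

theorem errMatrix_apply (C : LinearCode N k F) (e : E) (t : N.InSink) :
    C.errMatrix e t = ∑ d, C.transfer e d * C.errMatrix d t + if e = t then 1 else 0 := by
  have hd := (Matrix.isUnit_iff_isUnit_det _).1 C.isUnit_one_sub_transfer
  have h := congrFun (congrFun (Matrix.mul_nonsing_inv _ hd) e) t
  rw [Matrix.sub_mul, Matrix.one_mul, Matrix.sub_apply, sub_eq_iff_eq_add', Matrix.one_apply] at h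
  exact h

theorem vecMul_encMatrix (C : LinearCode N k F) (x : N.sources × Fin k → F) :
    x ᵥ* C.encMatrix = (x ᵥ* C.src) ᵥ* C.errMatrix := by
  rw [encMatrix, Matrix.vecMul_vecMul]

/-- The contributions of the edges leaving a source are spanned by those of the edges of a cut. -/
theorem errMatrix_mem_span_cut (C : LinearCode N k F) {S : Finset E} {u : V}
    (hS : ∀ l : List E, IsDiPath N.tail N.head u l N.sink → ∃ e ∈ l, e ∈ S) (e : E)
    (he : N.tail e = u) : C.errMatrix e ∈ Submodule.span F (C.errMatrix '' S) := by
  induction e using N.wellFounded_follows.induction generalizing u with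
  | _ e ih =>
    by_cases heS : e ∈ S
    · exact Submodule.subset_span ⟨e, heS, rfl⟩
    · have hS' : ∀ l : List E, IsDiPath N.tail N.head (N.head e) l N.sink →
          ∃ d ∈ l, d ∈ S := by
        intro l hl
        obtain ⟨d, hd, hdS⟩ := hS (e :: l) ⟨he, hl⟩
        rcases List.mem_cons.1 hd with rfl | hd
        · exact absurd hdS heS
        · exact ⟨d, hd, hdS⟩
      have hrow : C.errMatrix e = ∑ d, C.transfer e d • C.errMatrix d := by
        funext t
        rw [errMatrix_apply, if_neg, add_zero, Finset.sum_apply]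
        · rfl
        · intro h
          obtain ⟨d, hd, -⟩ := hS' [] (by rw [h]; exact t.2)
          simp at hd
      rw [hrow]
      refine Submodule.sum_mem _ fun d _ => ?_
      by_cases hd : N.tail d = N.head e
      · exact Submodule.smul_mem _ _ (ih d hd.symm hS' hd)
      · rw [C.transfer_eq_zero e d hd, zero_smul]
        exact Submodule.zero_mem _

/-- The Singleton-type bound for computing sums. -/
theorem exists_card_eq_of_computes (C : LinearCode N k F) (hk : 0 < k) (hkh : k ≤ N.minCut) :
    ∃ ρ : Finset E, (C.Phi (sumTarget N F) ∩ C.Delta ρ).Nonempty ∧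
      ρ.card = N.minCut - k + 1 := by
  classical
  obtain ⟨S, ⟨σ, hσ, hS⟩, hcard⟩ := N.exists_isCut_card_eq_minCut
  have hmem : ∀ j : Fin k, C.encMatrix (⟨σ, hσ⟩, j) ∈ Submodule.span F (C.errMatrix '' S) := by
    intro j
    have hrow : C.encMatrix (⟨σ, hσ⟩, j) = ∑ e, C.src (⟨σ, hσ⟩, j) e • C.errMatrix e := by
      funext t
      rw [encMatrix, Matrix.mul_apply, Finset.sum_apply]
      rfl
    rw [hrow]
    refine Submodule.sum_mem _ fun e _ => ?_
    by_cases he : N.tail e = σ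
    · exact Submodule.smul_mem _ _ (C.errMatrix_mem_span_cut hS e he)
    · rw [C.src_eq_zero ⟨σ, hσ⟩ j e he, zero_smul]
      exact Submodule.zero_mem _
  choose c hc using fun j => (Submodule.mem_span_image_finset_iff_exists_fun' F).1 (hmem j)
  -- This leaves `k - 1` edges of `S` outside `ρ`, hence `k - 1` linear conditions on the `k`
  -- entries of `m`.
  obtain ⟨ρ, hρS, hρ⟩ := Finset.exists_subset_card_eq (s := S) (n := N.minCut - k + 1) (by omega)
  let f : (Fin k → F) →ₗ[F] ({e // e ∈ S \ ρ} → F) :=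
    Matrix.vecMulLinear (Matrix.of fun j (e : {e // e ∈ S \ ρ}) => c j e)
  obtain ⟨m, hm, hm0⟩ := (Submodule.ne_bot_iff _).1 (f.ker_ne_bot_of_finrank_lt (by
    rw [Module.finrank_fintype_fun_eq_card, Module.finrank_fintype_fun_eq_card, Fintype.card_coe,
      Fintype.card_fin, Finset.card_sdiff_of_subset hρS]
    omega))
  have hzero : ∀ e ∈ S, e ∉ ρ → ∑ j, m j * c j e = 0 := fun e he he' =>
    congrFun (LinearMap.mem_ker.1 hm) ⟨e, Finset.mem_sdiff.2 ⟨he, he'⟩⟩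
  -- Only `σ` sends, so the target value is `m` itself and there is no cancellation between sources.
  let x : N.sources × Fin k → F := fun p => if p.1 = ⟨σ, hσ⟩ then m p.2 else 0
  refine ⟨ρ, ⟨x ᵥ* C.encMatrix, ⟨x, fun h => hm0 ?_, rfl⟩,
    fun e => if e ∈ ρ then ∑ j, m j * c j e else 0, fun e he => if_neg he, ?_⟩, hρ⟩
  · funext j
    have := congrFun h ((), j)
    rw [target_sumTarget] at this
    simpa [x] using this
  · funext t
    have h1 : (x ᵥ* C.encMatrix) t = ∑ j, m j * C.encMatrix (⟨σ, hσ⟩, j) t := by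
      simp [x, Matrix.vecMul, dotProduct, Fintype.sum_prod_type, ite_mul,
        Finset.sum_ite_irrel]
    have h2 : ∀ j, C.encMatrix (⟨σ, hσ⟩, j) t = ∑ e ∈ S, c j e * C.errMatrix e t := by
      intro j
      rw [← hc j, Finset.sum_apply]
      rfl
    rw [h1]
    simp only [h2, Matrix.vecMul, dotProduct, ite_mul, zero_mul, Finset.sum_ite_mem,
      Finset.univ_inter, Finset.mul_sum]
    rw [Finset.sum_comm]
    simp only [← mul_assoc, ← Finset.sum_mul]
    refine (Finset.sum_subset hρS fun e he he' => ?_).symm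
    rw [hzero e he he', zero_mul]

/-! ### The code attaining the bound. -/

/-- A linear map on the received vectors that sends the contributions of the edges to given vectors
compatible with the transfer coefficients. -/
theorem exists_linearMap_vecMul_errMatrix {W : Type*} [AddCommGroup W] [Module F W]
    (C : LinearCode N k F) {g : E → W}
    (hne : ∀ e, N.head e ≠ N.sink → g e = ∑ d, C.transfer e d • g d)
    (heq : ∀ e, N.head e = N.sink → ∀ d, C.transfer e d = 0) :
    ∃ D : (N.InSink → F) →ₗ[F] W, ∀ z : E → F, D (z ᵥ* C.errMatrix) = ∑ e, z e • g e := by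
  classical
  have : Fintype N.InSink := Fintype.ofFinite _
  -- `D` is fixed on the edges entering the sink; the transfer recursion, obeyed by the rows of the
  -- error matrix and by `g`, carries the identity to the other edges.
  let D : (N.InSink → F) →ₗ[F] W := Fintype.linearCombination F fun t : N.InSink => g t
  have hD : ∀ e, D (C.errMatrix e) = g e := by
    intro e
    induction e using N.wellFounded_follows.induction with
    | _ e ih =>
      by_cases he : N.head e = N.sink
      · have hrow : C.errMatrix e = Pi.single (⟨e, he⟩ : N.InSink) 1 := by
          funext t
          rw [errMatrix_apply]
          simp [heq e he, Pi.single_apply, Subtype.ext_iff, eq_comm]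
        rw [hrow]
        simp [D]
      · have hrow : C.errMatrix e = ∑ d, C.transfer e d • C.errMatrix d := by
          funext t
          rw [errMatrix_apply, if_neg, add_zero, Finset.sum_apply]
          · rfl
          · intro h
            exact he (h ▸ t.2)
        rw [hrow, map_sum, hne e he]
        refine Finset.sum_congr rfl fun d _ => ?_
        rw [map_smul]
        by_cases hd : N.tail d = N.head e
        · rw [ih d hd.symm]
        · rw [C.transfer_eq_zero e d hd, zero_smul, zero_smul]
  refine ⟨D, fun z => ?_⟩
  rw [Matrix.vecMul_eq_sum, map_sum]
  refine Finset.sum_congr rfl fun e _ => ?_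
  rw [map_smul]
  exact congrArg _ (hD e)

/-- Over a large field some code computes the sum of the messages and attains the Singleton-type
bound. -/
theorem exists_code (N : Network V E) (hkh : k ≤ N.minCut)
    (hF : ((2 ^ Fintype.card E : ℕ) : ℕ∞) < ENat.card F) :
    ∃ C : LinearCode N k F, C.Computes (sumTarget N F) ∧
      ∀ ρ : Finset E, (C.Phi (sumTarget N F) ∩ C.Delta ρ).Nonempty →
        N.minCut - k + 1 ≤ ρ.card := by
  classical
  obtain ⟨g, hg, hspan⟩ := N.exists_edgeVectors (W := Fin N.minCut → F) hF (by simp)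
  obtain ⟨w, hw⟩ := exists_vectors_sum_smul_notMem
    (ι := {ρ : Finset E // ρ.card ≤ N.minCut - k})
    (lt_of_le_of_lt (by
      rw [Nat.cast_le, ← Fintype.card_finset]
      exact Fintype.card_subtype_le _) hF)
    (fun ρ => Submodule.span F (g '' ρ.1)) (r := N.minCut - k) (fun ρ => by
      rw [← Finset.coe_image]
      exact (finrank_span_finset_le_card _).trans (Finset.card_image_le.trans ρ.2)) k
    (by simp; omega)
  have hcomb : ∀ u : V, ∀ v ∈ Submodule.span F (g '' {d | N.tail d = u}),
      ∃ c : E → F, (∀ d, N.tail d ≠ u → c d = 0) ∧ ∑ d, c d • g d = v := by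
    intro u v hv
    rw [← Finset.coe_filter_univ, Submodule.mem_span_image_finset_iff_exists_fun'] at hv
    obtain ⟨c, hc⟩ := hv
    refine ⟨fun d => if N.tail d = u then c d else 0, fun d hd => if_neg hd, ?_⟩
    rw [← hc, Finset.sum_filter]
    simp only [ite_smul, zero_smul]
  have htr : ∀ e, ∃ c : E → F, (∀ d, N.tail d ≠ N.head e → c d = 0) ∧
      (N.head e ≠ N.sink → g e = ∑ d, c d • g d) ∧ (N.head e = N.sink → ∀ d, c d = 0) := by
    intro e
    by_cases he : N.head e = N.sink
    · exact ⟨0, fun _ _ => rfl, fun h => absurd he h, fun _ _ => rfl⟩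
    · obtain ⟨c, h1, h2⟩ := hcomb _ _ (hg e he)
      exact ⟨c, h1, fun _ => h2.symm, fun h => absurd h he⟩
  choose K hK0 hKne hKeq using htr
  -- The vector `w p.2` does not depend on the source, which is why `D` sees only the sums of the
  -- messages.
  have hsrc : ∀ p : N.sources × Fin k, ∃ c : E → F, (∀ d, N.tail d ≠ p.1 → c d = 0) ∧
      ∑ d, c d • g d = w p.2 := fun p => hcomb _ _ (by rw [hspan _ p.1.2]; trivial)
  choose A hA0 hA using hsrc
  let C : LinearCode N k F := ⟨A, K, fun σ j => hA0 (σ, j), hK0⟩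
  obtain ⟨D, hD⟩ := C.exists_linearMap_vecMul_errMatrix hKne hKeq
  have hDx : ∀ x, D (x ᵥ* C.encMatrix) = ∑ j, target k (sumTarget N F) x ((), j) • w j := by
    intro x
    rw [vecMul_encMatrix, hD]
    simp only [Matrix.vecMul, dotProduct, Finset.sum_smul, target_sumTarget]
    rw [Finset.sum_comm, Fintype.sum_prod_type_right]
    refine Finset.sum_congr rfl fun j _ => Finset.sum_congr rfl fun σ _ => ?_
    rw [← hA (σ, j), Finset.smul_sum]
    simp only [mul_smul]
    rfl
  have hnot : ∀ t : Unit × Fin k → F, t ≠ 0 → ∀ ρ : Finset E, ρ.card ≤ N.minCut - k →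
      ∑ j, t ((), j) • w j ∉ Submodule.span F (g '' ρ) := by
    intro t ht ρ hρ
    refine hw (fun j => t ((), j)) (fun h => ht ?_) ⟨ρ, hρ⟩
    funext p
    exact congrFun h p.2
  refine ⟨C, ?_, ?_⟩
  · have hfac : ∀ x y, x ᵥ* C.encMatrix = y ᵥ* C.encMatrix →
        target k (sumTarget N F) x = target k (sumTarget N F) y := by
      intro x y hxy
      by_contra hne
      -- Computability is the case of no errors: with `ρ = ∅` the span is zero, so a nonzero target
      -- difference survives `D`.
      refine hnot _ (sub_ne_zero.2 hne) ∅ (by simp) ?_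
      have := congrArg D hxy
      rw [hDx, hDx, ← sub_eq_zero, ← Finset.sum_sub_distrib] at this
      simp only [Pi.sub_apply, sub_smul, this]
      exact Submodule.zero_mem _
    -- The decoder takes the arbitrary value `0` on vectors that are never received without error.
    exact ⟨Function.extend (fun x => x ᵥ* C.encMatrix) (target k (sumTarget N F)) 0,
      fun x => Function.FactorsThrough.extend_apply (fun x y => hfac x y) 0 x⟩
  · rintro ρ ⟨y, ⟨x, hx, hxy⟩, z, hz, hzy⟩
    by_contra! hρ
    refine hnot _ hx ρ (by omega) ?_
    rw [← hDx, ← hxy, hzy, hD]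
    refine Submodule.sum_mem _ fun e _ => ?_
    by_cases he : e ∈ ρ
    · exact Submodule.smul_mem _ _ (Submodule.subset_span ⟨e, he, rfl⟩)
    · rw [hz e he, zero_smul]
      exact Submodule.zero_mem _

end LinearCode

theorem mainTheorem1 {V E : Type*} [Fintype V] [Fintype E] [DecidableEq E]
    (N : Network V E) (k : ℕ) (hk : 0 < k) (hkh : k ≤ N.minCut) :
    ∃ q₀ : ℕ, ∀ (F : Type*) [Field F] [Fintype F], q₀ ≤ Fintype.card F →
      ∃ C : LinearCode N k F, C.Computes (sumTarget N F) ∧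
        C.minDist (sumTarget N F) = N.minCut - k + 1 := by
  refine ⟨2 ^ Fintype.card E + 1, fun F _ _ hF => ?_⟩
  obtain ⟨C, hC, hle⟩ := LinearCode.exists_code (F := F) N hkh (by
    rw [ENat.card_eq_coe_fintype_card, Nat.cast_lt]
    exact hF)
  have hmem := C.exists_card_eq_of_computes hk hkh
  refine ⟨C, hC, le_antisymm (Nat.sInf_le hmem) (le_csInf ⟨_, hmem⟩ ?_)⟩
  rintro n ⟨ρ, hρ, rfl⟩
  exact hle ρ hρ
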